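/- Let $n\ge 3$ and let $W=W(\widetilde A_{n-1})$ be the affine Weyl group of type $\widetilde A_{n-1}$, that is, the Coxeter group with generators $s_i$ ($i\in\mathbb Z/n\mathbb Z$) and relations $s_i^2=1$, $s_is_{i+1}s_i=s_{i+1}s_is_{i+1}$ for all $i$, and $s_is_j=s_js_i$ whenever $j\neq i,\,i\pm1$. Let $W$ act on $\mathbb Z$ from the left by letting $s_i$ act as the permutation with $t\mapsto t+1$ if $t\equiv i$, $t\mapsto t-1$ if $t\equiv i+1$, and $t\mapsto t$ otherwise (congruences modulo $n$). This identifies $W$ with the group of permutations $\sigma$ of $\mathbb Z$ such that $\sigma(t+n)=\sigma(t)+n$ for all $t\in\mathbb Z$ and $\sum_{t=1}^n\sigma(t)=\sum_{t=1}^n t$ (Lusztig): the action is faithful, and its image is exactly this set of permutations. Let $W$ also act linearly on the root lattice $\bigoplus_{j\in\mathbb Z/n\mathbb Z}\mathbb Z\alpha_j$ by $s_i\alpha_i=-\alpha_i$, $s_i\alpha_j=\alpha_j+\alpha_i$ if $j=i\pm1$, and $s_i\alpha_j=\alpha_j$ otherwise. The roots are the vectors $u(\alpha_j)$ with $u\in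 W$ and $j\in\mathbb Z/n\mathbb Z$; a root is positive (negative, written $<0$) if all its coefficients with respect to the $\alpha_j$ are $\ge 0$ (respectively $\le 0$). Then for every $w\in W$ the following four conditions are equivalent: (i) $w$ is fully commutative, i.e. no reduced expression for $w$ in the generators $s_i$ contains a string of three consecutive letters of the form $s_is_js_i$; (ii) for all $a,b\in\mathbb Z$ with $a<b$ and $w(a)>w(b)$, one has $w(a)>a$ and $w(b)<b$; (iii) $w$ is $321$-avoiding, i.e. there are no integers $a<b<c$ with $w(a)>w(b)>w(c)$; (iv) there are no positive roots $\alpha,\beta$ such that $\alpha+\beta$ is also a positive root and $w(\alpha)<0$ and $w(\beta)<0$. -/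

import Mathlib

namespace AffineA

/-- The Coxeter matrix of the Dynkin diagram of type `Ã_{n-1}` for `3 ≤ n`: the vertices are the
residues modulo `n`, arranged in a cycle, with `i` and `j` adjacent iff they differ by one. -/
def coxeterMatrix (n : ℕ) : CoxeterMatrix (ZMod n) where
  M := Matrix.of fun i j => if i = j then 1 else if j = i + 1 ∨ i = j + 1 then 3 else 2
  isSymm := by
    ext i j
    simp only [Matrix.transpose_apply, Matrix.of_apply, eq_comm (a := j) (b := i),
      or_comm (a := i = j + 1)]
  diagonal i := by simp
  off_diagonal i j h := by
    simp only [Matrix.of_apply, if_neg h]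
    split_ifs <;> decide

/-- The affine Weyl group `W(Ã_{n-1})`: the Coxeter group presented by the generators `s i`,
for `i` a residue modulo `n`, and the relations of the Coxeter matrix of type `Ã_{n-1}`. -/
abbrev W (n : ℕ) : Type := (coxeterMatrix n).Group

/-- The Coxeter system structure on `W n`. -/
abbrev cs (n : ℕ) : CoxeterSystem (coxeterMatrix n) (W n) := (coxeterMatrix n).toCoxeterSystem

theorem zmod_ne {n : ℕ} (hn : 3 ≤ n) : (1 : ZMod n) ≠ 0 ∧ (2 : ZMod n) ≠ 0 := by
  constructor
  · intro h
    have h' : ((1 : ℕ) : ZMod n) = 0 := by exact_mod_cast h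
    rw [ZMod.natCast_eq_zero_iff] at h'
    have := Nat.le_of_dvd (by norm_num) h'
    omega
  · intro h
    have h' : ((2 : ℕ) : ZMod n) = 0 := by exact_mod_cast h
    rw [ZMod.natCast_eq_zero_iff] at h'
    have := Nat.le_of_dvd (by norm_num) h'
    omega

/-- A family of involutions indexed by the residues modulo `n` that satisfies the braid and
commutation relations of type `Ã_{n-1}` extends to `W n`. -/
theorem isLiftable {n : ℕ} {G : Type*} [Monoid G] (f : ZMod n → G) (hinv : ∀ i, f i * f i = 1)
    (hbraid : ∀ i, f i * f (i + 1) * f i = f (i + 1) * f i * f (i + 1))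
    (hcomm : ∀ i j, i ≠ j → j ≠ i + 1 → i ≠ j + 1 → f i * f j = f j * f i) :
    (coxeterMatrix n).IsLiftable f := by
  have key : ∀ a b : G, a * a = 1 → b * b = 1 → a * b * a = b * a * b → (a * b) ^ 3 = 1 := by
    intro a b ha hb h
    have h1 : (a * b) ^ 3 = (a * b * a) * (b * a * b) := by simp only [pow_succ, pow_zero, one_mul,
      mul_assoc]
    rw [h1, ← h]
    have h2 : a * b * a * (a * b * a) = a * (b * (a * a) * b) * a := by simp only [mul_assoc]
    rw [h2, ha, mul_one, hb, mul_one, ha]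
  intro i j
  change (f i * f j) ^ (if i = j then 1 else if j = i + 1 ∨ i = j + 1 then 3 else 2) = 1
  split_ifs with h1 h2
  · subst h1
    rw [pow_one, hinv]
  · rcases h2 with h2 | h2
    · subst h2
      exact key _ _ (hinv _) (hinv _) (hbraid _)
    · subst h2
      exact key _ _ (hinv _) (hinv _) (hbraid _).symm
  · push Not at h2
    have h3 : (f i * f j) ^ 2 = f i * (f j * f i) * f j := by
      simp only [pow_succ, pow_zero, one_mul, mul_assoc]
    rw [h3, ← hcomm i j h1 h2.1 h2.2, ← mul_assoc, hinv, one_mul, hinv]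

/-! ### The realization by permutations of the integers -/

/-- The map on `ℤ` that adds `1` to the integers congruent to `i` modulo `n`, subtracts `1` from
those congruent to `i + 1`, and fixes all others. -/
def swapFun (n : ℕ) (i : ZMod n) (t : ℤ) : ℤ :=
  if (t : ZMod n) = i then t + 1 else if (t : ZMod n) = i + 1 then t - 1 else t

theorem swap_aux {R : Type*} [CommRing R] [DecidableEq R] (h1 : (1 : R) ≠ 0) (h2 : (2 : R) ≠ 0)
    (s : R → ℤ → ℤ)
    (hs : ∀ i t, s i t = if (t : R) = i then t + 1 else if (t : R) = i + 1 then t - 1 else t) :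
    (∀ i t, s i (s i t) = t) ∧
    (∀ i t, s i (s (i + 1) (s i t)) = s (i + 1) (s i (s (i + 1) t))) ∧
    (∀ i j, i ≠ j → j ≠ i + 1 → i ≠ j + 1 → ∀ t, s i (s j t) = s j (s i t)) := by
  have e1 : ∀ i (t : ℤ), (t : R) = i → s i t = t + 1 := by intro i t h; rw [hs, if_pos h]
  have e2 : ∀ i (t : ℤ), (t : R) = i + 1 → s i t = t - 1 := by
    intro i t h
    rw [hs, if_neg (by rw [h]; simpa using h1), if_pos h]
  have e3 : ∀ i (t : ℤ), (t : R) ≠ i → (t : R) ≠ i + 1 → s i t = t := by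
    intro i t h h'
    rw [hs, if_neg h, if_neg h']
  clear hs
  refine ⟨?_, ?_, ?_⟩
  · intro i t
    by_cases c1 : (t : R) = i
    · rw [e1 i t c1, e2 i _ (by push_cast; rw [c1])]; ring
    by_cases c2 : (t : R) = i + 1
    · rw [e2 i t c2, e1 i _ (by push_cast; rw [c2]; ring)]; ring
    rw [e3 i t c1 c2, e3 i t c1 c2]
  · intro i t
    have h1' : i + 1 ≠ i := by simpa using h1
    have h2' : i + 2 ≠ i := by simpa using h2
    by_cases c1 : (t : R) = i
    · rw [e1 i t c1, e1 (i + 1) (t + 1) (by push_cast; grind),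
        e3 i (t + 1 + 1) (by push_cast; grind) (by push_cast; grind),
        e3 (i + 1) t (by grind) (by grind), e1 i t c1, e1 (i + 1) (t + 1) (by push_cast; grind)]
    by_cases c2 : (t : R) = i + 1
    · rw [e2 i t c2, e3 (i + 1) (t - 1) (by push_cast; grind) (by push_cast; grind),
        e1 i (t - 1) (by push_cast; grind), e1 (i + 1) t c2,
        e3 i (t + 1) (by push_cast; grind) (by push_cast; grind),
        e2 (i + 1) (t + 1) (by push_cast; grind)]
      ring
    by_cases c3 : (t : R) = i + 1 + 1
    · rw [e3 i t c1 c2, e2 (i + 1) t c3, e2 i (t - 1) (by push_cast; grind),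
        e3 (i + 1) (t - 1 - 1) (by push_cast; grind) (by push_cast; grind)]
    rw [e3 i t c1 c2, e3 (i + 1) t c2 c3, e3 i t c1 c2, e3 (i + 1) t c2 c3]
  · intro i j hij hj hi t
    have h1' : i + 1 ≠ i := by simpa using h1
    have h2' : i + 2 ≠ i := by simpa using h2
    by_cases c1 : (t : R) = i
    · rw [e1 i t c1, e3 j t (by grind) (by grind), e1 i t c1,
        e3 j (t + 1) (by push_cast; grind) (by push_cast; grind)]
    by_cases c2 : (t : R) = i + 1
    · rw [e2 i t c2, e3 j t (by grind) (by grind), e2 i t c2,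
        e3 j (t - 1) (by push_cast; grind) (by push_cast; grind)]
    by_cases c3 : (t : R) = j
    · rw [e1 j t c3, e3 i t c1 c2, e1 j t c3,
        e3 i (t + 1) (by push_cast; grind) (by push_cast; grind)]
    by_cases c4 : (t : R) = j + 1
    · rw [e2 j t c4, e3 i t c1 c2, e2 j t c4,
        e3 i (t - 1) (by push_cast; grind) (by push_cast; grind)]
    rw [e3 i t c1 c2, e3 j t c3 c4, e3 i t c1 c2]

theorem swapFun_aux {n : ℕ} (hn : 3 ≤ n) :
    (∀ i t, swapFun n i (swapFun n i t) = t) ∧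
    (∀ i t, swapFun n i (swapFun n (i + 1) (swapFun n i t)) =
      swapFun n (i + 1) (swapFun n i (swapFun n (i + 1) t))) ∧
    (∀ i j, i ≠ j → j ≠ i + 1 → i ≠ j + 1 → ∀ t,
      swapFun n i (swapFun n j t) = swapFun n j (swapFun n i t)) :=
  swap_aux (zmod_ne hn).1 (zmod_ne hn).2 (swapFun n) (fun _ _ => rfl)

/-- The permutation of `ℤ` by which the generator `s i` acts. -/
def swap {n : ℕ} (hn : 3 ≤ n) (i : ZMod n) : Equiv.Perm ℤ where
  toFun := swapFun n i
  invFun := swapFun n i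
  left_inv := (swapFun_aux hn).1 i
  right_inv := (swapFun_aux hn).1 i

theorem swap_isLiftable {n : ℕ} (hn : 3 ≤ n) : (coxeterMatrix n).IsLiftable (swap hn) := by
  obtain ⟨ha, hb, hc⟩ := swapFun_aux hn
  exact isLiftable _ (fun i => Equiv.ext (ha i)) (fun i => Equiv.ext (hb i))
    (fun i j h h' h'' => Equiv.ext (hc i j h h' h''))

/-- The left action of `W(Ã_{n-1})` on `ℤ`, as a homomorphism to the permutations of `ℤ`;
the generator `s i` acts as `swap hn i`. -/
def toPerm {n : ℕ} (hn : 3 ≤ n) : W n →* Equiv.Perm ℤ :=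
  (cs n).lift ⟨swap hn, swap_isLiftable hn⟩

theorem toPerm_simple {n : ℕ} (hn : 3 ≤ n) (i : ZMod n) (t : ℤ) :
    toPerm hn ((cs n).simple i) t =
      if (t : ZMod n) = i then t + 1 else if (t : ZMod n) = i + 1 then t - 1 else t := by
  rw [toPerm, CoxeterSystem.lift_apply_simple]
  rfl

/-- The permutations of `ℤ` that form Lusztig's realization of `W(Ã_{n-1})`. -/
def IsAffinePerm (n : ℕ) (σ : Equiv.Perm ℤ) : Prop :=
  (∀ i : ℤ, σ (i + n) = σ i + n) ∧
    ∑ t ∈ Finset.Icc (1 : ℤ) n, σ t = ∑ t ∈ Finset.Icc (1 : ℤ) n, t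

/-! ### The root system -/

/-- The root lattice of type `Ã_{n-1}`; `v i` is the coefficient of the simple root `α_i`. -/
abbrev RootLattice (n : ℕ) : Type := ZMod n → ℤ

/-- The simple root `α_i`. -/
def simpleRoot {n : ℕ} (i : ZMod n) : RootLattice n := Pi.single i 1

/-- The simple reflection `s_i` on the root lattice: it sends `∑ v_j α_j` to the combination with
the coefficient of `α_i` replaced by `v_{i-1} + v_{i+1} - v_i`. -/
def reflection {n : ℕ} (i : ZMod n) : Module.End ℤ (RootLattice n) where
  toFun v k := if k = i then v (i - 1) + v (i + 1) - v i else v k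
  map_add' v w := by
    ext k
    simp only [Pi.add_apply]
    split_ifs <;> ring
  map_smul' c v := by
    ext k
    simp only [Pi.smul_apply, smul_eq_mul, RingHom.id_apply]
    split_ifs <;> ring

theorem refl_aux {R : Type*} [CommRing R] [DecidableEq R] (h1 : (1 : R) ≠ 0) (h2 : (2 : R) ≠ 0)
    (s : R → (R → ℤ) → R → ℤ)
    (hs : ∀ i v k, s i v k = if k = i then v (i - 1) + v (i + 1) - v i else v k) :
    (∀ i v, s i (s i v) = v) ∧
    (∀ i v, s i (s (i + 1) (s i v)) = s (i + 1) (s i (s (i + 1) v))) ∧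
    (∀ i j, i ≠ j → j ≠ i + 1 → i ≠ j + 1 → ∀ v, s i (s j v) = s j (s i v)) ∧
    (∀ i j, s i (Pi.single j 1) =
      if i = j then -Pi.single j 1
      else if i = j - 1 ∨ i = j + 1 then Pi.single j 1 + Pi.single i 1
      else Pi.single j 1) := by
  have f1 : ∀ x : R, x + 1 ≠ x := fun x h => h1 (by linear_combination h)
  have f2 : ∀ x : R, x - 1 ≠ x := fun x h => h1 (by linear_combination -h)
  have f3 : ∀ x : R, x + 1 + 1 ≠ x := fun x h => h2 (by linear_combination h)
  have f4 : ∀ x : R, x - 1 ≠ x + 1 := fun x h => h2 (by linear_combination -h)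
  have f5 : ∀ x : R, x + 1 - 1 = x := fun x => by ring
  have f6 : ∀ x : R, x - 1 + 1 = x := fun x => by ring
  refine ⟨?_, ?_, ?_, ?_⟩
  · intro i v
    ext k
    simp only [hs, f1, f2, if_false, if_true]
    grind
  · intro i v
    ext k
    simp only [hs, f1, f2, f3, f4, f5, (f1 _).symm, if_false, if_true]
    split_ifs <;> grind
  · intro i j hij hj hi v
    have g1 : i - 1 ≠ j := fun h => hi (by linear_combination h)
    have g2 : i + 1 ≠ j := fun h => hj h.symm
    have g3 : j - 1 ≠ i := fun h => hj (by linear_combination h)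
    have g4 : j + 1 ≠ i := fun h => hi h.symm
    ext k
    simp only [hs, g1, g2, g3, g4, hij, hij.symm, if_false]
    split_ifs <;> grind
  · intro i j
    ext k
    rw [hs]
    have g1 := f1 j
    have g2 := f2 j
    have g3 := f4 j
    have g5 := f5 j
    have g6 := f6 j
    have g7 := f5 i
    have g8 := f6 i
    split_ifs <;> simp only [Pi.single_apply, Pi.neg_apply, Pi.add_apply] <;> grind

theorem reflection_simpleRoot {n : ℕ} (hn : 3 ≤ n) (i j : ZMod n) :
    reflection i (simpleRoot j) =
      if i = j then -simpleRoot j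
      else if i = j - 1 ∨ i = j + 1 then simpleRoot j + simpleRoot i
      else simpleRoot j :=
  (refl_aux (zmod_ne hn).1 (zmod_ne hn).2 (fun i v => reflection (n := n) i v)
    (fun _ _ _ => rfl)).2.2.2 i j

theorem reflection_isLiftable {n : ℕ} (hn : 3 ≤ n) :
    (coxeterMatrix n).IsLiftable (reflection (n := n)) := by
  obtain ⟨ha, hb, hc, -⟩ :=
    refl_aux (zmod_ne hn).1 (zmod_ne hn).2 (fun i v => reflection (n := n) i v) (fun _ _ _ => rfl)
  exact isLiftable _ (fun i => LinearMap.ext (ha i)) (fun i => LinearMap.ext (hb i))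
    (fun i j h h' h'' => LinearMap.ext (hc i j h h' h''))

/-- The left action of `W(Ã_{n-1})` on the root lattice; `s i` acts as `reflection i`. -/
def rootAction {n : ℕ} (hn : 3 ≤ n) : Representation ℤ (W n) (RootLattice n) :=
  (cs n).lift ⟨reflection, reflection_isLiftable hn⟩

theorem rootAction_simple {n : ℕ} (hn : 3 ≤ n) (i : ZMod n) :
    rootAction hn ((cs n).simple i) = reflection i := by
  rw [rootAction, CoxeterSystem.lift_apply_simple]

/-- The roots are the images of the simple roots under `W(Ã_{n-1})`. -/
def IsRoot {n : ℕ} (hn : 3 ≤ n) (v : RootLattice n) : Prop :=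
  ∃ (w : W n) (i : ZMod n), v = rootAction hn w (simpleRoot i)

/-- A positive root: a root all of whose coefficients at the simple roots are nonnegative. -/
def IsPositiveRoot {n : ℕ} (hn : 3 ≤ n) (v : RootLattice n) : Prop :=
  IsRoot hn v ∧ ∀ i, 0 ≤ v i

/-- A negative root: a root all of whose coefficients at the simple roots are nonpositive. -/
def IsNegativeRoot {n : ℕ} (hn : 3 ≤ n) (v : RootLattice n) : Prop :=
  IsRoot hn v ∧ ∀ i, v i ≤ 0

/-! ### The conditions of the theorem -/

/-- `w` is fully commutative: no reduced expression for `w` contains a string of consecutive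
letters of the form `s i * s j * s i`. -/
def IsFullyCommutative {n : ℕ} (w : W n) : Prop :=
  ∀ ω : List (ZMod n), (cs n).IsReduced ω → (cs n).wordProd ω = w →
    ∀ i j : ZMod n, ¬ [i, j, i] <:+: ω

/-- A permutation of `ℤ` is `321`-avoiding. -/
def Is321Avoiding (σ : Equiv.Perm ℤ) : Prop :=
  ¬ ∃ a b c : ℤ, a < b ∧ b < c ∧ σ a > σ b ∧ σ b > σ c

end AffineA

namespace AffineA

/-! Everything is read off the permutation of `ℤ`. The bridge is `length_lt_iff`: `s_a` lengthens
`w` on the right exactly when `w(a) < w(a + 1)`. It makes the action faithful, and sorting descents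
reaches every affine permutation.

(i) and (iii): a factor `s_i s_j s_i` in a reduced word reverses three consecutive positions, and
later letters of the word never destroy a 321-pattern. Conversely, descents are stripped from `w`
without losing the pattern, until it sits on consecutive positions; there a braid factor splits off.

(ii) and (iii): the sum normalization makes an affine permutation that preserves a left half-line
preserve the complementary right half-line (`forall_apply_lt_iff`). If (ii) fails for an inversion
of a 321-avoiding `w`, some half-line is preserved while the inversion crosses its boundary.

(iii) and (iv): the positive roots are the differences `p_b - p_a` with `a < b` incongruent, where
`p` is `rootPotential`, and `w` sends `p_b - p_a` to `p_{w(b)} - p_{w(a)}`. So inversions are the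
positive roots made negative, and a 321-pattern is two composable inversions. -/

variable {n : ℕ}

/-! ### Relations and the generators on `ℤ` -/

theorem braid_relation (i : ZMod n) (hn : 3 ≤ n) :
    (cs n).simple i * (cs n).simple (i + 1) * (cs n).simple i =
      (cs n).simple (i + 1) * (cs n).simple i * (cs n).simple (i + 1) := by
  have h := (cs n).simple_mul_simple_pow i (i + 1)
  have hM : coxeterMatrix n i (i + 1) = 3 := by
    change (if i = i + 1 then 1 else if i + 1 = i + 1 ∨ i = i + 1 + 1 then 3 else 2) = 3
    rw [if_neg (by simpa using (zmod_ne hn).1), if_pos (Or.inl rfl)]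
  rw [hM] at h
  have h2 : ((cs n).simple i * (cs n).simple (i + 1)) ^ 3 =
      ((cs n).simple i * (cs n).simple (i + 1) * (cs n).simple i) *
      ((cs n).simple (i + 1) * (cs n).simple i * (cs n).simple (i + 1)) := by
    simp only [pow_succ, pow_zero, one_mul, mul_assoc]
  rw [h2] at h
  rw [eq_inv_of_mul_eq_one_left h]
  simp only [mul_inv_rev, CoxeterSystem.inv_simple, mul_assoc]

theorem comm_relation {i j : ZMod n} (hij : i ≠ j) (hj : j ≠ i + 1) (hi : i ≠ j + 1) :
    (cs n).simple i * (cs n).simple j = (cs n).simple j * (cs n).simple i := by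
  have h := (cs n).simple_mul_simple_pow i j
  have hM : coxeterMatrix n i j = 2 := by
    change (if i = j then 1 else if j = i + 1 ∨ i = j + 1 then 3 else 2) = 2
    rw [if_neg hij, if_neg (by tauto)]
  rw [hM, pow_two] at h
  rw [eq_inv_of_mul_eq_one_left h]
  simp only [mul_inv_rev, CoxeterSystem.inv_simple]

theorem toPerm_simple_self (hn : 3 ≤ n) (a : ℤ) : toPerm hn ((cs n).simple a) a = a + 1 := by
  rw [toPerm_simple, if_pos rfl]

theorem toPerm_simple_succ (hn : 3 ≤ n) (a : ℤ) : toPerm hn ((cs n).simple a) (a + 1) = a := by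
  rw [toPerm_simple, if_neg (by simpa using (zmod_ne hn).1), if_pos (by push_cast; rfl)]
  ring

theorem toPerm_simple_of_ne (hn : 3 ≤ n) {i : ZMod n} {t : ℤ} (h : (t : ZMod n) ≠ i)
    (h' : (t : ZMod n) ≠ i + 1) : toPerm hn ((cs n).simple i) t = t := by
  rw [toPerm_simple, if_neg h, if_neg h']

theorem toPerm_mul_apply (hn : 3 ≤ n) (u v : W n) (t : ℤ) :
    toPerm hn (u * v) t = toPerm hn u (toPerm hn v t) := by
  rw [map_mul]; rfl

/-! ### Affine permutations and sums over a period -/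

/-- Sums of a periodic function over windows of one period agree. -/
theorem sum_window_eq {g : ℤ → ℤ} (hg : ∀ t, g (t + n) = g t) (a b : ℤ) :
    ∑ k ∈ Finset.range n, g (a + k) = ∑ k ∈ Finset.range n, g (b + k) := by
  have step : ∀ a : ℤ, ∑ k ∈ Finset.range n, g (a + 1 + k) = ∑ k ∈ Finset.range n, g (a + k) := by
    intro a
    have h1 := Finset.sum_range_succ (fun k : ℕ => g (a + k)) n
    have h2 := Finset.sum_range_succ' (fun k : ℕ => g (a + k)) n
    rw [h1] at h2
    simp only [hg, Nat.cast_zero, add_zero] at h2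
    rw [add_right_cancel h2]
    refine Finset.sum_congr rfl fun k _ => ?_
    congr 1
    push_cast
    ring
  have key : ∀ c : ℤ, ∑ k ∈ Finset.range n, g (c + k) = ∑ k ∈ Finset.range n, g (0 + k) := by
    intro c
    induction c using Int.induction_on with
    | zero => rfl
    | succ i ih => rw [step, ih]
    | pred i ih => rw [← ih, ← step (-(i : ℤ) - 1)]; simp
  rw [key a, key b]

/-- The displacement `σ t - t` is periodic, so the window `[1, n]` may be replaced by one that
starts wherever a swap takes place. -/
theorem isAffinePerm_iff {σ : Equiv.Perm ℤ} :
    IsAffinePerm n σ ↔ (∀ t : ℤ, σ (t + n) = σ t + n) ∧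
      ∀ a : ℤ, ∑ k ∈ Finset.range n, (σ (a + k) - (a + k)) = 0 := by
  refine and_congr_right fun h => ?_
  have hw : ∀ f : ℤ → ℤ, ∑ t ∈ Finset.Icc (1 : ℤ) n, f t = ∑ k ∈ Finset.range n, f (1 + k) := by
    intro f
    symm
    refine Finset.sum_nbij (fun k : ℕ => 1 + (k : ℤ)) ?_ ?_ ?_ (fun _ _ => rfl)
    · intro k hk
      simp only [Finset.mem_range, Finset.mem_Icc] at hk ⊢
      omega
    · intro x _ y _ hxy
      simpa using hxy
    · intro t ht
      simp only [Finset.coe_Icc, Set.mem_Icc] at ht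
      refine ⟨(t - 1).toNat, ?_, ?_⟩
      · simp only [Finset.coe_range, Set.mem_Iio]; omega
      · simp only; omega
  rw [← sub_eq_zero, ← Finset.sum_sub_distrib, hw]
  constructor
  · intro h1 a
    rw [← h1]
    exact sum_window_eq (g := fun t => σ t - t) (fun t => by rw [h]; ring) a 1
  · intro h1
    exact h1 1

theorem intCast_eq_iff {a b : ℤ} : (a : ZMod n) = b ↔ ∃ k : ℤ, b = a + k * n := by
  rw [ZMod.intCast_eq_intCast_iff_dvd_sub]
  constructor
  · rintro ⟨k, hk⟩
    exact ⟨k, by linear_combination hk⟩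
  · rintro ⟨k, hk⟩
    exact ⟨k, by linear_combination hk⟩

theorem apply_add_mul {σ : Equiv.Perm ℤ} (h : ∀ t : ℤ, σ (t + n) = σ t + n) (t k : ℤ) :
    σ (t + k * n) = σ t + k * n := by
  induction k using Int.induction_on with
  | zero => simp
  | succ i ih => rw [add_mul, one_mul, ← add_assoc, h, ih]; ring
  | pred i ih =>
    have := h (t + (-(i : ℤ) - 1) * n)
    rw [show t + (-(i : ℤ) - 1) * n + n = t + -(i : ℤ) * n by ring, ih] at this
    linear_combination -this

theorem intCast_apply_eq_iff {σ : Equiv.Perm ℤ} (h : ∀ t : ℤ, σ (t + n) = σ t + n) {a b : ℤ} :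
    (σ a : ZMod n) = σ b ↔ (a : ZMod n) = b := by
  simp only [intCast_eq_iff]
  refine exists_congr fun k => ?_
  rw [← apply_add_mul h]
  exact σ.injective.eq_iff

/-- Sums over a window starting at `a` of a function and its modification at `a`, `a + 1`. -/
theorem sum_window_sub (hn : 3 ≤ n) {f g : ℤ → ℤ} (a : ℤ)
    (h : ∀ t : ℤ, (t : ZMod n) ≠ a → (t : ZMod n) ≠ a + 1 → f t = g t) :
    ∑ k ∈ Finset.range n, f (a + k) - ∑ k ∈ Finset.range n, g (a + k) =
      (f a + f (a + 1)) - (g a + g (a + 1)) := by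
  obtain ⟨m, rfl⟩ : ∃ m, n = m + 1 + 1 := ⟨n - 2, by omega⟩
  rw [Finset.sum_range_succ', Finset.sum_range_succ', Finset.sum_range_succ' _ (m + 1),
    Finset.sum_range_succ' _ m]
  have : ∑ k ∈ Finset.range m, f (a + ((k + 1 + 1 : ℕ) : ℤ)) =
      ∑ k ∈ Finset.range m, g (a + ((k + 1 + 1 : ℕ) : ℤ)) := by
    refine Finset.sum_congr rfl fun k hk => h _ ?_ ?_
    · intro h1
      push_cast at h1
      have h2 : ((k + 2 : ℕ) : ZMod (m + 1 + 1)) = 0 := by push_cast; linear_combination h1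
      rw [ZMod.natCast_eq_zero_iff] at h2
      have := Nat.le_of_dvd (by omega) h2
      simp at hk
      omega
    · intro h1
      push_cast at h1
      have h2 : ((k + 1 : ℕ) : ZMod (m + 1 + 1)) = 0 := by push_cast; linear_combination h1
      rw [ZMod.natCast_eq_zero_iff] at h2
      have := Nat.le_of_dvd (by omega) h2
      simp at hk
      omega
  rw [this]
  push_cast
  simp only [add_zero]
  ring

theorem isAffinePerm_one : IsAffinePerm n 1 := ⟨fun _ => rfl, rfl⟩

theorem IsAffinePerm.mul_simple (hn : 3 ≤ n) {σ : Equiv.Perm ℤ} (h : IsAffinePerm n σ)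
    (i : ZMod n) : IsAffinePerm n (σ * toPerm hn ((cs n).simple i)) := by
  obtain ⟨a, rfl⟩ := ZMod.intCast_surjective i
  rw [isAffinePerm_iff] at h ⊢
  have hper : ∀ t : ℤ, (σ * toPerm hn ((cs n).simple a)) (t + n) =
      (σ * toPerm hn ((cs n).simple a)) t + n := by
    intro t
    simp only [Equiv.Perm.mul_apply, ← h.1]
    congr 1
    simp only [toPerm_simple]
    push_cast
    simp only [CharP.cast_eq_zero, add_zero]
    split_ifs <;> ring
  refine ⟨hper, fun b => ?_⟩
  rw [sum_window_eq (g := fun t => (σ * toPerm hn ((cs n).simple a)) t - t)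
    (fun t => by rw [hper]; ring) b a]
  have := sum_window_sub hn (f := fun t => (σ * toPerm hn ((cs n).simple a)) t - t)
    (g := fun t => σ t - t) a (fun t h1 h2 => by
      simp only [Equiv.Perm.mul_apply, toPerm_simple_of_ne hn h1 h2])
  rw [h.2 a] at this
  simp only [Equiv.Perm.mul_apply, toPerm_simple_self, toPerm_simple_succ] at this ⊢
  linear_combination this

theorem isAffinePerm_toPerm (hn : 3 ≤ n) (w : W n) : IsAffinePerm n (toPerm hn w) := by
  induction w using (cs n).simple_induction_right with
  | one => rw [map_one]; exact isAffinePerm_one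
  | mul_simple_right w i ih => rw [map_mul]; exact ih.mul_simple hn i

theorem toPerm_add_mul (hn : 3 ≤ n) (w : W n) (t k : ℤ) :
    toPerm hn w (t + k * n) = toPerm hn w t + k * n :=
  apply_add_mul (isAffinePerm_toPerm hn w).1 t k

/-- An inversion of an affine permutation involves two distinct residues. -/
theorem intCast_ne_of_inversion (hn : 3 ≤ n) {w : W n} {a b : ℤ} (hab : a < b)
    (h : toPerm hn w b < toPerm hn w a) : (a : ZMod n) ≠ b := by
  intro he
  obtain ⟨k, rfl⟩ := intCast_eq_iff.1 he
  rw [toPerm_add_mul] at h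
  linarith

theorem toPerm_simple_succ_add_two (hn : 3 ≤ n) (a : ℤ) :
    toPerm hn ((cs n).simple a) (a + 2) = a + 2 := by
  apply toPerm_simple_of_ne
  · push_cast
    simpa using (zmod_ne hn).2
  · push_cast
    intro h
    exact (zmod_ne hn).1 (by linear_combination h)

theorem toPerm_simple_add_one_self (hn : 3 ≤ n) (a : ℤ) :
    toPerm hn ((cs n).simple (a + 1)) a = a := by
  apply toPerm_simple_of_ne
  · simpa using (zmod_ne hn).1
  · intro h
    exact (zmod_ne hn).2 (by linear_combination -h)

theorem toPerm_simple_add_one_add_one (hn : 3 ≤ n) (a : ℤ) :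
    toPerm hn ((cs n).simple (a + 1)) (a + 1) = a + 2 := by
  have := toPerm_simple_self hn (a + 1)
  push_cast at this
  rw [this]; ring

theorem toPerm_simple_add_one_add_two (hn : 3 ≤ n) (a : ℤ) :
    toPerm hn ((cs n).simple (a + 1)) (a + 2) = a + 1 := by
  have := toPerm_simple_succ hn (a + 1)
  push_cast at this
  rw [← this]; congr 1; ring

/-! ### Length, descents and faithfulness -/

theorem length_mul_simple_le (w : W n) (i : ZMod n) :
    (cs n).length (w * (cs n).simple i) ≤ (cs n).length w + 1 := by
  rcases (cs n).length_mul_simple w i with h | h <;> omega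

theorem exists_eq_mul_simple (w : W n) (i : ZMod n) : ∃ x, w = x * (cs n).simple i :=
  ⟨w * (cs n).simple i, ((cs n).simple_mul_simple_cancel_right i).symm⟩

/-- If right multiplication by `s a` increases the length, then `a` is an ascent. -/
theorem apply_lt_of_length_lt (hn : 3 ≤ n) (w : W n) (a : ℤ)
    (h : (cs n).length w < (cs n).length (w * (cs n).simple a)) :
    toPerm hn w a < toPerm hn w (a + 1) := by
  induction hl : (cs n).length w using Nat.strong_induction_on generalizing w a with
  | _ l ih =>
  subst hl
  by_cases hw : w = 1
  · subst hw
    simp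
  -- Write `w = x s_j` with `x` shorter, and distinguish whether `j` follows `a`, precedes it, or
  -- commutes with it.
  obtain ⟨j, hj⟩ := (cs n).exists_rightDescent_of_ne_one hw
  rw [CoxeterSystem.isRightDescent_iff] at hj
  obtain ⟨x, rfl⟩ : ∃ x, w = x * (cs n).simple j :=
          exists_eq_mul_simple _ _
  rw [CoxeterSystem.simple_mul_simple_cancel_right] at hj
  by_cases hja : j = a
  · subst hja
    rw [CoxeterSystem.simple_mul_simple_cancel_right] at h
    omega
  have ihx : ∀ b : ℤ, (cs n).length x < (cs n).length (x * (cs n).simple b) →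
      toPerm hn x b < toPerm hn x (b + 1) := fun b hb => ih _ (by omega) x b hb rfl
  have hxa := (cs n).length_mul_simple x a
  by_cases hj1 : j = a + 1
  · subst hj1
    rw [toPerm_mul_apply, toPerm_mul_apply, toPerm_simple_add_one_self,
      toPerm_simple_add_one_add_one]
    rcases hxa with hxa | hxa
    · have h1 := ihx a (by omega)
      have h2 := ihx (a + 1) (by push_cast; omega)
      rw [show a + 1 + 1 = a + 2 by ring] at h2
      omega
    · obtain ⟨y, rfl⟩ : ∃ y, x = y * (cs n).simple a :=
          exists_eq_mul_simple _ _
      rw [CoxeterSystem.simple_mul_simple_cancel_right] at hxa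
      rw [toPerm_mul_apply, toPerm_mul_apply, toPerm_simple_self, toPerm_simple_succ_add_two]
      have h2 := ih _ (by omega) y (a + 1) (by
        push_cast
        rcases (cs n).length_mul_simple y (a + 1) with h3 | h3
        · omega
        -- Otherwise `y = z s_{a+1}`, and the braid relation turns `w s_a` into `z s_a s_{a+1}`,
        -- which is shorter than `w`.
        · exfalso
          obtain ⟨z, rfl⟩ : ∃ z, y = z * (cs n).simple (a + 1) :=
          exists_eq_mul_simple _ _
          rw [CoxeterSystem.simple_mul_simple_cancel_right] at h3
          have h4 : z * (cs n).simple (a + 1) * (cs n).simple a * (cs n).simple (a + 1) *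
              (cs n).simple a = z * (cs n).simple a * (cs n).simple (a + 1) := by
            rw [mul_assoc z, mul_assoc z, ← braid_relation _ hn, mul_assoc z,
              CoxeterSystem.simple_mul_simple_cancel_right, mul_assoc]
          rw [h4] at h
          have h5 := length_mul_simple_le (z * (cs n).simple a) (a + 1)
          have h6 := length_mul_simple_le z (a : ZMod n)
          omega) rfl
      rw [show a + 1 + 1 = a + 2 by ring] at h2
      exact h2
  by_cases hj2 : (a : ZMod n) = j + 1
  · obtain ⟨b, rfl⟩ : ∃ b, a = b + 1 := ⟨a - 1, by ring⟩
    obtain rfl : j = b := by push_cast at hj2; exact (add_right_cancel hj2).symm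
    rw [show b + 1 + 1 = b + 2 by ring]
    rw [toPerm_mul_apply, toPerm_mul_apply, toPerm_simple_succ, toPerm_simple_succ_add_two]
    push_cast at h hxa
    rcases hxa with hxa | hxa
    · have h1 := ihx b (by omega)
      have h2 := ihx (b + 1) (by push_cast; omega)
      rw [show b + 1 + 1 = b + 2 by ring] at h2
      omega
    · obtain ⟨y, rfl⟩ : ∃ y, x = y * (cs n).simple (b + 1) :=
          exists_eq_mul_simple _ _
      rw [CoxeterSystem.simple_mul_simple_cancel_right] at hxa
      rw [toPerm_mul_apply, toPerm_mul_apply, toPerm_simple_add_one_self,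
        toPerm_simple_add_one_add_two]
      refine ih _ (by omega) y b ?_ rfl
      rcases (cs n).length_mul_simple y b with h3 | h3
      · omega
      · exfalso
        obtain ⟨z, rfl⟩ : ∃ z, y = z * (cs n).simple b :=
          exists_eq_mul_simple _ _
        rw [CoxeterSystem.simple_mul_simple_cancel_right] at h3
        have h4 : z * (cs n).simple b * (cs n).simple (b + 1) * (cs n).simple b *
            (cs n).simple (b + 1) = z * (cs n).simple (b + 1) * (cs n).simple b := by
          rw [mul_assoc z, mul_assoc z, braid_relation _ hn, mul_assoc z,
            CoxeterSystem.simple_mul_simple_cancel_right, mul_assoc]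
        rw [h4] at h
        have h5 := length_mul_simple_le (z * (cs n).simple (b + 1)) b
        have h6 := length_mul_simple_le z (b + 1 : ZMod n)
        omega
  · have hcomm := comm_relation (n := n) (Ne.symm hja) hj1 hj2
    have e1 : toPerm hn ((cs n).simple j) a = a := toPerm_simple_of_ne hn (Ne.symm hja) hj2
    have e2 : toPerm hn ((cs n).simple j) (a + 1) = a + 1 := by
      apply toPerm_simple_of_ne
      · push_cast; exact Ne.symm hj1
      · push_cast; intro h; exact hja (add_right_cancel h).symm
    rw [toPerm_mul_apply, toPerm_mul_apply, e1, e2]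
    apply ihx
    rcases hxa with hxa | hxa
    · omega
    · exfalso
      rw [mul_assoc, ← hcomm, ← mul_assoc] at h
      have := length_mul_simple_le (x * (cs n).simple a) j
      omega

/-- If the length drops, the implication already proved applies to `w s_a` and gives a descent of
`w` at `a`. -/
theorem length_lt_iff (hn : 3 ≤ n) (w : W n) (a : ℤ) :
    (cs n).length w < (cs n).length (w * (cs n).simple a) ↔
      toPerm hn w a < toPerm hn w (a + 1) := by
  refine ⟨apply_lt_of_length_lt hn w a, fun h => ?_⟩
  by_contra hc
  have h1 := apply_lt_of_length_lt hn (w * (cs n).simple a) a (by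
    rw [CoxeterSystem.simple_mul_simple_cancel_right]
    have := (cs n).length_mul_simple_ne w a
    omega)
  rw [toPerm_mul_apply, toPerm_mul_apply, toPerm_simple_self, toPerm_simple_succ] at h1
  omega

theorem length_mul_simple_of_gt (hn : 3 ≤ n) {w : W n} {a : ℤ}
    (h : toPerm hn w (a + 1) < toPerm hn w a) :
    (cs n).length (w * (cs n).simple a) + 1 = (cs n).length w := by
  have := mt (length_lt_iff hn w a).1 h.not_gt
  rcases (cs n).length_mul_simple w a with h | h <;> omega

/-- A nontrivial element has a right descent, whereas the identity permutation has none. -/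
theorem toPerm_injective (hn : 3 ≤ n) : Function.Injective (toPerm hn) := by
  rw [injective_iff_map_eq_one]
  intro w hw
  by_contra h1
  obtain ⟨j, hj⟩ := (cs n).exists_rightDescent_of_ne_one h1
  obtain ⟨a, rfl⟩ := ZMod.intCast_surjective j
  have := (length_lt_iff hn w a).2 (by rw [hw]; simp)
  rw [CoxeterSystem.IsRightDescent] at hj
  omega

/-! ### Surjectivity onto the affine permutations -/

/-- An affine permutation without descents is the identity. -/
theorem IsAffinePerm.eq_one {σ : Equiv.Perm ℤ} (h : IsAffinePerm n σ) (hn : 3 ≤ n)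
    (hd : ∀ a, σ a < σ (a + 1)) : σ = 1 := by
  have hmono : StrictMono σ := strictMono_int_of_lt_succ hd
  -- An increasing bijection of `ℤ` skips no value, so it is a translation; the sum condition then
  -- makes it trivial.
  have hsucc : ∀ a, σ (a + 1) = σ a + 1 := by
    intro a
    obtain ⟨c, hc⟩ := σ.surjective (σ a + 1)
    have h1 : a < c := hmono.lt_iff_lt.1 (by omega)
    have h2 : σ (a + 1) ≤ σ c := hmono.monotone (by omega)
    have := hd a
    omega
  have htrans : ∀ a, σ a = σ 0 + a := by
    intro a
    induction a using Int.induction_on with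
    | zero => simp
    | succ i ih => rw [hsucc, ih]; ring
    | pred i ih =>
      have := hsucc (-(i : ℤ) - 1)
      rw [sub_add_cancel, ih] at this
      linarith
  have hsum := (isAffinePerm_iff.1 h).2 0
  have hterm : ∀ k : ℕ, σ (0 + k) - (0 + k) = σ 0 := fun k => by rw [htrans (0 + k)]; ring
  rw [Finset.sum_congr rfl fun k _ => hterm k, Finset.sum_const, Finset.card_range, nsmul_eq_mul,
    mul_eq_zero] at hsum
  have h0 : (n : ℤ) ≠ 0 := by omega
  ext a
  rw [htrans a, (hsum.resolve_left h0)]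
  simp

/-- Bubble sort: removing a descent at `a` lowers the sum of squared displacements over a period by
`2 (σ a - σ (a + 1))`. -/
theorem exists_toPerm_eq (hn : 3 ≤ n) (σ : Equiv.Perm ℤ) (h : IsAffinePerm n σ) :
    ∃ w, toPerm hn w = σ := by
  induction hl : (∑ k ∈ Finset.range n, (σ (0 + k) - (0 + k)) ^ 2).toNat
    using Nat.strong_induction_on generalizing σ with
  | _ l ih =>
  subst hl
  by_cases hd : ∀ a, σ a < σ (a + 1)
  · exact ⟨1, by rw [map_one, h.eq_one hn hd]⟩
  push Not at hd
  obtain ⟨a, ha⟩ := hd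
  have ha' : σ (a + 1) < σ a := lt_of_le_of_ne ha (fun he => by simpa using σ.injective he)
  have hper := fun {τ : Equiv.Perm ℤ} (hτ : IsAffinePerm n τ) => sum_window_eq (n := n)
    (g := fun t => (τ t - t) ^ 2) (fun t => by rw [hτ.1]; ring) 0 a
  have h' := h.mul_simple hn a
  obtain ⟨w, hw⟩ := ih _ (by
    have hs := sum_window_sub hn
      (f := fun t => ((σ * toPerm hn ((cs n).simple a)) t - t) ^ 2)
      (g := fun t => (σ t - t) ^ 2) a (fun t h1 h2 => by
        simp only [Equiv.Perm.mul_apply, toPerm_simple_of_ne hn h1 h2])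
    have e1 := hper h
    have e2 := hper h'
    simp only [Equiv.Perm.mul_apply, toPerm_simple_self, toPerm_simple_succ] at hs e1 e2 ⊢
    have hpos : 0 ≤ ∑ k ∈ Finset.range n,
        (σ (toPerm hn ((cs n).simple a) (0 + k)) - (0 + k)) ^ 2 :=
      Finset.sum_nonneg fun k _ => sq_nonneg _
    rw [← e1, ← e2] at hs
    have : ∑ k ∈ Finset.range n, (σ (toPerm hn ((cs n).simple a) (0 + k)) - (0 + k)) ^ 2 <
        ∑ k ∈ Finset.range n, (σ (0 + k) - (0 + k)) ^ 2 := by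
      nlinarith
    omega) _ h' rfl
  refine ⟨w * (cs n).simple a, ?_⟩
  rw [map_mul, hw, mul_assoc, ← map_mul, CoxeterSystem.simple_mul_simple_self, map_one, mul_one]

theorem range_toPerm (hn : 3 ≤ n) :
    Set.range (toPerm hn) = {σ : Equiv.Perm ℤ | IsAffinePerm n σ} := by
  ext σ
  constructor
  · rintro ⟨w, rfl⟩
    exact isAffinePerm_toPerm hn w
  · exact exists_toPerm_eq hn σ

/-! ### Half-lines, and (ii) ⇔ (iii) -/

/-- An affine permutation that maps the integers below `m` to integers below `m` also maps
the integers from `m` on to integers from `m` on. -/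
theorem IsAffinePerm.le_apply {σ : Equiv.Perm ℤ} (h : IsAffinePerm n σ) (hn : 3 ≤ n) {m : ℤ}
    (hm : ∀ t, t < m → σ t < m) {b : ℤ} (hb : m ≤ b) : m ≤ σ b := by
  have hn0 : (0 : ℤ) < n := by omega
  obtain ⟨c, hc⟩ : ∃ c : ℤ, m = c + n := ⟨m - n, by ring⟩
  subst hc
  have hsum := (isAffinePerm_iff.1 h).2 c
  -- the residues of the values on the window `[c, c + n)` form the same window
  let r : ℕ → ℕ := fun k => ((σ (c + k) - c) % n).toNat
  have hr : ∀ k, (r k : ℤ) = (σ (c + k) - c) % n := fun k =>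
    Int.toNat_of_nonneg (Int.emod_nonneg _ hn0.ne')
  have hrmem : ∀ k, r k ∈ Finset.range n := by
    intro k
    have := Int.emod_lt_of_pos (σ (c + k) - c) hn0
    rw [Finset.mem_range]
    have := hr k
    omega
  have hinj : Set.InjOn r (Finset.range n) := by
    intro k hk l hl hkl
    have h1 : (σ (c + k) - c) % n = (σ (c + l) - c) % n := by rw [← hr, ← hr, hkl]
    have h2 : (σ (c + k) : ZMod n) = σ (c + l) := by
      have := (ZMod.intCast_eq_intCast_iff' _ _ n).2 h1
      push_cast at this
      exact sub_left_injective this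
    rw [intCast_apply_eq_iff h.1] at h2
    push_cast at h2
    have h3 : (k : ZMod n) = l := add_left_cancel h2
    rw [ZMod.natCast_eq_natCast_iff'] at h3
    rw [Finset.coe_range, Set.mem_Iio] at hk hl
    rwa [Nat.mod_eq_of_lt hk, Nat.mod_eq_of_lt hl] at h3
  have himage : (Finset.range n).image r = Finset.range n := by
    apply Finset.eq_of_subset_of_card_le
    · intro x hx
      obtain ⟨k, -, rfl⟩ := Finset.mem_image.1 hx
      exact hrmem k
    · rw [Finset.card_image_of_injOn hinj]
  have hrsum : ∑ k ∈ Finset.range n, (r k : ℤ) = ∑ k ∈ Finset.range n, (k : ℤ) := by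
    conv_rhs => rw [← himage]
    rw [Finset.sum_image hinj]
  -- Values on the window `[c, m)` stay below `m`, so each offset is at most its residue. The two
  -- totals agree, hence all are equal and `σ` permutes the window.
  have hle : ∀ k ∈ Finset.range n, σ (c + k) - c ≤ r k := by
    intro k hk
    rw [hr]
    have h1 := hm (c + k) (by rw [Finset.mem_range] at hk; omega)
    by_cases h2 : 0 ≤ σ (c + k) - c
    · rw [Int.emod_eq_of_lt h2 (by omega)]
    · have := Int.emod_nonneg (σ (c + k) - c) hn0.ne'
      omega
  have heq : ∀ k ∈ Finset.range n, σ (c + k) - c = r k := by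
    rw [← Finset.sum_eq_sum_iff_of_le hle, hrsum, ← sub_eq_zero, ← Finset.sum_sub_distrib, ← hsum]
    exact Finset.sum_congr rfl fun k _ => by ring
  have hk0 := Int.emod_nonneg (b - c) hn0.ne'
  have hk1 := Int.emod_lt_of_pos (b - c) hn0
  obtain ⟨k, hk⟩ := Int.eq_ofNat_of_zero_le hk0
  have hdiv := Int.emod_add_mul_ediv (b - c) n
  have hbk : b = c + k + (b - c) / n * n := by rw [← hk]; linear_combination -hdiv
  have hq : 1 ≤ (b - c) / n := by
    rw [Int.le_ediv_iff_mul_le hn0]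
    omega
  rw [hbk, apply_add_mul h.1]
  have h1 := heq k (by rw [Finset.mem_range]; omega)
  have h2 : (n : ℤ) ≤ (b - c) / n * n := by nlinarith
  omega

/-- A permutation in the affine Weyl group maps the integers below `m` to integers below `m` iff
it maps the integers from `m` on to integers from `m` on. -/
theorem forall_apply_lt_iff (hn : 3 ≤ n) (w : W n) (m : ℤ) :
    (∀ t, t < m → toPerm hn w t < m) ↔ ∀ t, m ≤ t → m ≤ toPerm hn w t := by
  constructor
  · intro h t ht
    exact (isAffinePerm_toPerm hn w).le_apply hn h ht
  · intro h t ht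
    have hinv : ∀ t, toPerm hn w (toPerm hn w⁻¹ t) = t := fun t => by
      rw [← toPerm_mul_apply, mul_inv_cancel, map_one]; rfl
    have hinv' : ∀ t, toPerm hn w⁻¹ (toPerm hn w t) = t := fun t => by
      rw [← toPerm_mul_apply, inv_mul_cancel, map_one]; rfl
    by_contra hc
    -- Since `w` preserves the right half-line, `w⁻¹` preserves the left one, to which the previous
    -- lemma applies.
    have := (isAffinePerm_toPerm hn w⁻¹).le_apply hn (m := m) (fun t ht => by
      by_contra hc
      have := h _ (not_lt.1 hc)
      rw [hinv] at this
      omega) (not_lt.1 hc)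
    rw [hinv'] at this
    omega

/-- If `w(a) ≤ a`, any `t < a` with `w(t) ≥ a` would complete a pattern `t, a, b`. So `w` preserves
the integers below `a`, hence those from `a` on, against `w(b) < w(a) ≤ a`. The bound at `b` is
symmetric. Conversely, the middle entry of a pattern would have to move both up and down. -/
theorem is321Avoiding_iff (hn : 3 ≤ n) (w : W n) :
    Is321Avoiding (toPerm hn w) ↔ ∀ a b : ℤ, a < b → toPerm hn w a > toPerm hn w b →
      toPerm hn w a > a ∧ toPerm hn w b < b := by
  constructor
  · intro h a b hab hw
    constructor
    · by_contra hc
      have hlt : ∀ t, t < a → toPerm hn w t < a := by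
        intro t ht
        by_contra ht'
        have hne : toPerm hn w t ≠ toPerm hn w a := fun he => ht.ne ((toPerm hn w).injective he)
        exact h ⟨t, a, b, ht, hab, by omega, hw⟩
      have := (forall_apply_lt_iff hn w a).1 hlt b hab.le
      omega
    · by_contra hc
      have hle : ∀ t, b ≤ t → b ≤ toPerm hn w t := by
        intro t ht
        by_contra ht'
        have hne : b ≠ t := by rintro rfl; omega
        exact h ⟨a, b, t, hab, by omega, hw, by omega⟩
      have := (forall_apply_lt_iff hn w b).2 hle a hab
      omega
  · rintro h ⟨a, b, c, hab, hbc, h1, h2⟩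
    have := (h a b hab h1).2
    have := (h b c hbc h2).1
    omega

/-! ### Patterns and reduced words, and (i) ⇔ (iii) -/

theorem toPerm_simple_lt (hn : 3 ≤ n) {i : ZMod n} {a b : ℤ} (hab : a < b)
    (h : b = a + 1 → (a : ZMod n) ≠ i) :
    toPerm hn ((cs n).simple i) a < toPerm hn ((cs n).simple i) b := by
  have h1 : b = a + 1 → (b : ZMod n) = a + 1 := by rintro rfl; push_cast; rfl
  have h2 : b = a + 2 → (b : ZMod n) = a + 2 := by rintro rfl; push_cast; rfl
  have hne := zmod_ne hn
  rw [toPerm_simple, toPerm_simple]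
  split_ifs with c1 c2 c3 c4 c5 c6 c7 c8
  · omega
  · have hb1 : b ≠ a + 1 := fun e => h e c1
    have hb2 : b ≠ a + 2 := fun e => hne.1 (by linear_combination (-1) * h2 e - c1 + c3)
    omega
  · have hb1 : b ≠ a + 1 := fun e => h e c1
    omega
  · omega
  · omega
  · omega
  · omega
  · have hb1 : b ≠ a + 1 := fun e => c1 (by linear_combination c8 - h1 e)
    omega
  · omega

theorem toPerm_mul_simple_apply_apply (hn : 3 ≤ n) (w : W n) (i : ZMod n) (t : ℤ) :
    toPerm hn (w * (cs n).simple i) (toPerm hn ((cs n).simple i) t) = toPerm hn w t := by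
  rw [← toPerm_mul_apply, CoxeterSystem.simple_mul_simple_cancel_right]

/-- A pattern of `w` at `a, b, c` is one of `w s_i` at the images of these positions under `s_i`,
provided their order survives. -/
theorem not_is321Avoiding_mul_simple_of_lt (hn : 3 ≤ n) {w : W n} {i : ZMod n}
    {a b c : ℤ} (hab : toPerm hn ((cs n).simple i) a < toPerm hn ((cs n).simple i) b)
    (hbc : toPerm hn ((cs n).simple i) b < toPerm hn ((cs n).simple i) c)
    (h1 : toPerm hn w b < toPerm hn w a) (h2 : toPerm hn w c < toPerm hn w b) :
    ¬ Is321Avoiding (toPerm hn (w * (cs n).simple i)) := by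
  refine not_not.2 ⟨_, _, _, hab, hbc, ?_, ?_⟩ <;>
  simpa only [toPerm_mul_simple_apply_apply]

/-- Multiplication by a simple reflection that increases the length preserves `321`-patterns. -/
theorem not_is321Avoiding_mul_simple (hn : 3 ≤ n) {w : W n} {i : ZMod n}
    (h : ¬ Is321Avoiding (toPerm hn w))
    (hl : (cs n).length w < (cs n).length (w * (cs n).simple i)) :
    ¬ Is321Avoiding (toPerm hn (w * (cs n).simple i)) := by
  obtain ⟨a, b, c, hab, hbc, h1, h2⟩ := not_not.1 h
  have key : ∀ {p q : ℤ}, p < q → toPerm hn w q < toPerm hn w p →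
      toPerm hn ((cs n).simple i) p < toPerm hn ((cs n).simple i) q := by
    intro p q hpq hw
    refine toPerm_simple_lt hn hpq ?_
    rintro rfl rfl
    rw [length_lt_iff hn] at hl
    omega
  exact not_is321Avoiding_mul_simple_of_lt hn (key hab h1) (key hbc h2) h1 h2

theorem isReduced_append_singleton {ω : List (ZMod n)} {i : ZMod n} :
    (cs n).IsReduced (ω ++ [i]) ↔ (cs n).IsReduced ω ∧
      (cs n).length ((cs n).wordProd ω * (cs n).simple i) =
        (cs n).length ((cs n).wordProd ω) + 1 := by
  have hp : (cs n).wordProd (ω ++ [i]) = (cs n).wordProd ω * (cs n).simple i := by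
    rw [CoxeterSystem.wordProd_append, CoxeterSystem.wordProd_singleton]
  constructor
  · intro h
    have h1 : (cs n).IsReduced ω := by simpa using h.take ω.length
    refine ⟨h1, ?_⟩
    rw [h1.eq, ← hp, h.eq]
    simp
  · rintro ⟨h1, h2⟩
    rw [CoxeterSystem.IsReduced, hp, h2, h1.eq]
    simp

theorem not_is321Avoiding_wordProd_append (hn : 3 ≤ n) (u q : List (ZMod n))
    (hr : (cs n).IsReduced (u ++ q))
    (h : ¬ Is321Avoiding (toPerm hn ((cs n).wordProd u))) :
    ¬ Is321Avoiding (toPerm hn ((cs n).wordProd (u ++ q))) := by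
  induction q generalizing u with
  | nil => simpa using h
  | cons i q ih =>
    rw [List.append_cons] at hr ⊢
    refine ih (u ++ [i]) hr ?_
    have hr' : (cs n).IsReduced (u ++ [i]) := by
      simpa only [List.take_left] using hr.take (u ++ [i]).length
    rw [isReduced_append_singleton] at hr'
    rw [CoxeterSystem.wordProd_append, CoxeterSystem.wordProd_singleton]
    exact not_is321Avoiding_mul_simple hn h (by omega)

/-- For `j = i + 1` the three length increases say `v(a) < v(a + 1) < v(a + 2)`, and `s_a s_{a+1}
s_a` reverses these positions. The braid relation reduces `i = j + 1` to this case; equal or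
commuting letters contradict the increases. -/
theorem not_is321Avoiding_of_braid (hn : 3 ≤ n) {v : W n} {i j : ZMod n}
    (h1 : (cs n).length (v * (cs n).simple i) = (cs n).length v + 1)
    (h2 : (cs n).length (v * (cs n).simple i * (cs n).simple j) =
      (cs n).length (v * (cs n).simple i) + 1)
    (h3 : (cs n).length (v * (cs n).simple i * (cs n).simple j * (cs n).simple i) =
      (cs n).length (v * (cs n).simple i * (cs n).simple j) + 1) :
    ¬ Is321Avoiding
      (toPerm hn (v * (cs n).simple i * (cs n).simple j * (cs n).simple i)) := by
  have key : ∀ a : ℤ,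
      (cs n).length v < (cs n).length (v * (cs n).simple a) →
      (cs n).length (v * (cs n).simple a) <
        (cs n).length (v * (cs n).simple a * (cs n).simple (a + 1)) →
      (cs n).length (v * (cs n).simple a * (cs n).simple (a + 1)) <
        (cs n).length (v * (cs n).simple a * (cs n).simple (a + 1) * (cs n).simple a) →
      ¬ Is321Avoiding
        (toPerm hn (v * (cs n).simple a * (cs n).simple (a + 1) * (cs n).simple a)) := by
    intro a h1 h2 h3
    have e := length_lt_iff hn (v * (cs n).simple a) (a + 1)
    rw [show a + 1 + 1 = a + 2 by ring] at e
    push_cast at e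
    rw [e] at h2
    rw [length_lt_iff hn] at h1 h3
    refine not_not.2 ⟨a, a + 1, a + 2, by omega, by omega, ?_⟩
    simp only [toPerm_mul_apply, toPerm_simple_self, toPerm_simple_succ,
      toPerm_simple_succ_add_two, toPerm_simple_add_one_self, toPerm_simple_add_one_add_one,
      toPerm_simple_add_one_add_two] at h2 h3 ⊢
    omega
  by_cases hij : i = j
  · subst hij
    rw [CoxeterSystem.simple_mul_simple_cancel_right] at h2
    omega
  by_cases hj : j = i + 1
  · subst hj
    obtain ⟨a, rfl⟩ := ZMod.intCast_surjective i
    exact key a (by omega) (by omega) (by omega)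
  by_cases hi : i = j + 1
  · subst hi
    obtain ⟨a, rfl⟩ := ZMod.intCast_surjective j
    have hb : v * (cs n).simple (a + 1) * (cs n).simple a * (cs n).simple (a + 1) =
        v * (cs n).simple a * (cs n).simple (a + 1) * (cs n).simple a := by
      simp only [mul_assoc v]
      rw [braid_relation _ hn]
    rw [hb] at h3 ⊢
    -- The total increase is three and each letter adds at most one, so the rewritten word also
    -- increases at every letter.
    have l1 := length_mul_simple_le v a
    have l2 := length_mul_simple_le (v * (cs n).simple a) (a + 1)
    have l3 := length_mul_simple_le (v * (cs n).simple a * (cs n).simple (a + 1)) a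
    exact key a (by omega) (by omega) (by omega)
  · rw [mul_assoc v, comm_relation hij hj hi, ← mul_assoc,
      CoxeterSystem.simple_mul_simple_cancel_right] at h3
    rw [mul_assoc v, comm_relation hij hj hi, ← mul_assoc] at h2
    have := length_mul_simple_le v j
    omega

theorem isFullyCommutative_of_is321Avoiding (hn : 3 ≤ n) {w : W n}
    (h : Is321Avoiding (toPerm hn w)) : IsFullyCommutative w := by
  rintro ω hr rfl i j ⟨p, q, rfl⟩
  refine not_is321Avoiding_wordProd_append hn _ _ hr ?_ h
  have hr' : (cs n).IsReduced (p ++ [i, j, i]) := by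
    simpa only [List.take_left] using hr.take (p ++ [i, j, i]).length
  have e : p ++ [i, j, i] = p ++ [i] ++ [j] ++ [i] := by simp
  rw [e] at hr' ⊢
  simp only [isReduced_append_singleton, CoxeterSystem.wordProd_append,
    CoxeterSystem.wordProd_singleton] at hr' ⊢
  exact not_is321Avoiding_of_braid hn hr'.1.1.2 hr'.1.2 hr'.2

theorem isReduced_append_of_gt (hn : 3 ≤ n) {w : W n} {a : ℤ} {ω : List (ZMod n)}
    (hd : toPerm hn w (a + 1) < toPerm hn w a) (hr : (cs n).IsReduced ω)
    (hω : (cs n).wordProd ω = w * (cs n).simple a) :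
    (cs n).IsReduced (ω ++ [(a : ZMod n)]) ∧ (cs n).wordProd (ω ++ [(a : ZMod n)]) = w := by
  have := length_mul_simple_of_gt hn hd
  rw [isReduced_append_singleton, CoxeterSystem.wordProd_append,
    CoxeterSystem.wordProd_singleton, hω, CoxeterSystem.simple_mul_simple_cancel_right]
  exact ⟨⟨hr, this.symm⟩, rfl⟩

/-- A `321`-pattern with minimal distance between its outer positions. -/
theorem exists_minimal_321 {σ : Equiv.Perm ℤ} (h : ¬ Is321Avoiding σ) :
    ∃ a b c : ℤ, (a < b ∧ b < c ∧ σ b < σ a ∧ σ c < σ b) ∧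
      ∀ a' b' c' : ℤ, a' < b' → b' < c' → σ b' < σ a' → σ c' < σ b' → c - a ≤ c' - a' := by
  classical
  have hex : ∃ m : ℕ, ∃ a b c : ℤ, (a < b ∧ b < c ∧ σ b < σ a ∧ σ c < σ b) ∧ c - a = m := by
    obtain ⟨a, b, c, hab, hbc, h1, h2⟩ := not_not.1 h
    exact ⟨(c - a).toNat, a, b, c, ⟨hab, hbc, h1, h2⟩, by omega⟩
  obtain ⟨a, b, c, habc, hm⟩ := Nat.find_spec hex
  refine ⟨a, b, c, habc, fun a' b' c' h1 h2 h3 h4 => ?_⟩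
  have := Nat.find_min' hex (m := (c' - a').toNat) ⟨a', b', c', ⟨h1, h2, h3, h4⟩, by omega⟩
  omega

/-- Induction on length with a tightest pattern `a < b < c`. A gap after `a` forces a descent at
`a`, as otherwise `a + 1, b, c` is tighter; if `b = a + 1`, a gap before `c` similarly forces a
descent at `c - 1`. Removing that descent keeps a pattern. -/
theorem not_isFullyCommutative_of_not_is321Avoiding (hn : 3 ≤ n) (w : W n)
    (h : ¬ Is321Avoiding (toPerm hn w)) : ¬ IsFullyCommutative w := by
  suffices ∃ ω : List (ZMod n), (cs n).IsReduced ω ∧ (cs n).wordProd ω = w ∧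
      ∃ i j : ZMod n, [i, j, i] <:+: ω by
    obtain ⟨ω, h1, h2, i, j, h3⟩ := this
    exact fun hf => hf ω h1 h2 i j h3
  induction hl : (cs n).length w using Nat.strong_induction_on generalizing w with
  | _ l ih =>
  subst hl
  have step : ∀ d : ℤ, toPerm hn w (d + 1) < toPerm hn w d →
      ¬ Is321Avoiding (toPerm hn (w * (cs n).simple d)) →
      ∃ ω : List (ZMod n), (cs n).IsReduced ω ∧ (cs n).wordProd ω = w ∧
      ∃ i j : ZMod n, [i, j, i] <:+: ω := by
    intro d hd h'
    have hlen := length_mul_simple_of_gt hn hd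
    obtain ⟨ω, h1, h2, i, j, h3⟩ := ih _ (by omega) _ h' rfl
    obtain ⟨h4, h5⟩ := isReduced_append_of_gt hn hd h1 h2
    exact ⟨_, h4, h5, i, j, h3.trans (List.infix_append' [] ω _)⟩
  obtain ⟨a, b, c, ⟨hab, hbc, h1, h2⟩, hmin⟩ := exists_minimal_321 h
  have nab := intCast_ne_of_inversion hn hab h1
  have nbc := intCast_ne_of_inversion hn hbc h2
  by_cases hb : b = a + 1
  · by_cases hc : c = a + 2
    · subst hb hc
      -- With consecutive positions, the letters `a, a + 1, a` appended to `ω` each lengthen the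
      -- word.
      obtain ⟨ω, hω, hω'⟩ := (cs n).exists_isReduced
        (w * (cs n).simple a * (cs n).simple (a + 1) * (cs n).simple a)
      have d2 := isReduced_append_of_gt hn (w := w * (cs n).simple a) (a := a + 1)
        (ω := ω ++ [(a : ZMod n)])
      have d3 := isReduced_append_of_gt hn (ω := ω)
        (w := w * (cs n).simple a * (cs n).simple (a + 1)) (a := a)
      rw [show a + 1 + 1 = a + 2 by ring] at d2
      push_cast at d2
      simp only [toPerm_mul_apply, toPerm_simple_self, toPerm_simple_succ,
        toPerm_simple_succ_add_two, toPerm_simple_add_one_self, toPerm_simple_add_one_add_one]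
        at d2 d3
      have r3 := d3 h2 hω hω'.symm
      have r2 := d2 (h2.trans h1) r3.1 r3.2
      have r1 := isReduced_append_of_gt hn h1 r2.1 r2.2
      exact ⟨_, r1.1, r1.2, a, a + 1, ω, [], by simp⟩
    · obtain ⟨d, rfl⟩ : ∃ d, c = d + 1 := ⟨c - 1, by ring⟩
      have hd : toPerm hn w (d + 1) < toPerm hn w d := by
        by_contra hcon
        have := hmin a b d hab (by omega) h1 (by omega)
        omega
      refine step d hd (not_is321Avoiding_mul_simple_of_lt hn
        (toPerm_simple_lt hn hab ?_) (toPerm_simple_lt hn hbc ?_) h1 h2)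
      -- The generator `s_d` also swaps all translates of `d, d + 1`; it could swap `a, b` only if
      -- `b ≡ c`, which an inversion excludes.
      · rintro rfl h
        exact nbc (by push_cast; rw [h])
      · intro h
        omega
  · have hd : toPerm hn w (a + 1) < toPerm hn w a := by
      by_contra hcon
      have := hmin (a + 1) b c (by omega) hbc (by omega) h2
      omega
    refine step a hd (not_is321Avoiding_mul_simple_of_lt hn
      (toPerm_simple_lt hn hab ?_) (toPerm_simple_lt hn hbc ?_) h1 h2)
    · exact fun h => absurd h hb
    · intro _ h
      exact nab h.symm

theorem isFullyCommutative_iff (hn : 3 ≤ n) (w : W n) :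
    IsFullyCommutative w ↔ Is321Avoiding (toPerm hn w) :=
  ⟨fun h => by_contra fun h' => not_isFullyCommutative_of_not_is321Avoiding hn w h' h,
    isFullyCommutative_of_is321Avoiding hn⟩

/-! ### Roots as differences of potentials -/

/-- The vectors `rootPotential t`, for `t : ℤ`, have the successive differences
`rootPotential (t + 1) - rootPotential t = simpleRoot t`. -/
def rootPotential (n : ℕ) (t : ℤ) : RootLattice n := fun i => -(((i.cast : ℤ) - t) / n)

/-- The quotients of `x - 1` and `x` by `n` differ only when `n ∣ x`. Thus for `a ≤ b` coefficient
`i` of `p_b - p_a` counts the integers in `[a, b)` congruent to `i`. -/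
theorem rootPotential_succ (hn : 3 ≤ n) (t : ℤ) :
    rootPotential n (t + 1) = rootPotential n t + simpleRoot (t : ZMod n) := by
  have hn0 : (0 : ℤ) < n := by omega
  ext i
  simp only [rootPotential, simpleRoot, Pi.add_apply, Pi.single_apply]
  have hi : i = t ↔ (n : ℤ) ∣ i.cast - t := by
    rw [← ZMod.intCast_eq_intCast_iff_dvd_sub, ZMod.intCast_zmod_cast, eq_comm]
  simp only [hi]
  rw [show (i.cast : ℤ) - (t + 1) = i.cast - t - 1 by ring]
  generalize (i.cast : ℤ) - t = x
  have e1 := Int.emod_add_mul_ediv x n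
  have b1 := Int.emod_nonneg x hn0.ne'
  have b2 := Int.emod_lt_of_pos x hn0
  split_ifs with h
  · obtain ⟨k, rfl⟩ := h
    have : (n * k - 1 : ℤ) / n = k - 1 := by
      rw [Int.ediv_eq_iff_of_pos hn0]
      constructor <;> linarith
    rw [this, Int.mul_ediv_cancel_left _ hn0.ne']
    ring
  · have h0 : x % n ≠ 0 := fun h0 => h (Int.dvd_of_emod_eq_zero h0)
    have : (x - 1) / n = x / n := by
      rw [Int.ediv_eq_iff_of_pos hn0]
      have : 0 < x % n := by omega
      constructor <;> linarith
    rw [this, add_zero]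

theorem rootPotential_mono (hn : 3 ≤ n) {a b : ℤ} (h : a ≤ b) (i : ZMod n) :
    rootPotential n a i ≤ rootPotential n b i := by
  have := Int.ediv_le_ediv (a := (i.cast : ℤ) - b) (b := i.cast - a) (c := n)
    (by omega) (by omega)
  simp only [rootPotential]
  omega

theorem eq_of_apply_succ_eq {X : Type*} {g : ℤ → X} (h : ∀ t, g (t + 1) = g t) (a b : ℤ) :
    g a = g b := by
  have key : ∀ c : ℤ, g c = g 0 := by
    intro c
    induction c using Int.induction_on with
    | zero => rfl
    | succ i ih => rw [h, ih]
    | pred i ih => rw [← ih, ← h (-(i : ℤ) - 1), sub_add_cancel]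
  rw [key a, key b]

theorem reflection_simpleRoot_eq_sub (hn : 3 ≤ n) (i : ZMod n) (t : ℤ) :
    reflection i (simpleRoot (t : ZMod n)) =
      rootPotential n (toPerm hn ((cs n).simple i) (t + 1)) -
        rootPotential n (toPerm hn ((cs n).simple i) t) := by
  have hne := zmod_ne hn
  rw [reflection_simpleRoot hn]
  by_cases h1 : i = t
  · subst h1
    rw [if_pos rfl, toPerm_simple_self, toPerm_simple_succ, rootPotential_succ hn]
    abel
  rw [if_neg h1]
  by_cases h2 : i = t - 1
  · obtain ⟨s, rfl⟩ : ∃ s, t = s + 1 := ⟨t - 1, by ring⟩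
    obtain rfl : i = s := by rw [h2]; push_cast; ring
    rw [if_pos (Or.inl h2), toPerm_simple_succ, show s + 1 + 1 = s + 2 by ring,
      toPerm_simple_succ_add_two, show s + 2 = s + 1 + 1 by ring, rootPotential_succ hn (s + 1),
      rootPotential_succ hn s]
    abel
  by_cases h3 : i = t + 1
  · subst h3
    rw [if_pos (Or.inr rfl), toPerm_simple_add_one_self, toPerm_simple_add_one_add_one,
      show t + 2 = t + 1 + 1 by ring, rootPotential_succ hn (t + 1), rootPotential_succ hn t]
    push_cast
    abel
  · rw [if_neg (by tauto), toPerm_simple_of_ne hn, toPerm_simple_of_ne hn,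
      rootPotential_succ hn t]
    · abel
    · exact Ne.symm h1
    · intro h; exact h2 (by rw [h]; ring)
    · push_cast; exact Ne.symm h3
    · push_cast; intro h; exact h1 (add_right_cancel h).symm

/-- The potential is equivariant only up to a constant: `s_i p_t - p_{s_i(t)}` does not depend on
`t`, and it cancels in differences. -/
theorem rootAction_sub (hn : 3 ≤ n) (w : W n) (a b : ℤ) :
    rootAction hn w (rootPotential n b - rootPotential n a) =
      rootPotential n (toPerm hn w b) - rootPotential n (toPerm hn w a) := by
  induction w using (cs n).simple_induction_left with
  | one => simp
  | mul_simple_left w i ih =>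
    rw [map_mul, Module.End.mul_apply, ih, toPerm_mul_apply, toPerm_mul_apply,
      rootAction_simple, map_sub]
    have := eq_of_apply_succ_eq (g := fun t => reflection i (rootPotential n t) -
      rootPotential n (toPerm hn ((cs n).simple i) t)) (fun t => by
        simp only [rootPotential_succ hn t, map_add, reflection_simpleRoot_eq_sub hn]
        abel) (toPerm hn w b) (toPerm hn w a)
    rw [sub_eq_sub_iff_add_eq_add] at this ⊢
    rw [this]
    abel

/-- Differencing around the cycle recovers the residues of the two endpoints from a root. -/
theorem rootPotential_sub_pred (hn : 3 ≤ n) (a b : ℤ) (k : ZMod n) :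
    (rootPotential n b - rootPotential n a) k - (rootPotential n b - rootPotential n a) (k - 1) =
      (if k = a then 1 else 0) - (if k = b then 1 else 0) := by
  have := eq_of_apply_succ_eq (g := fun t => rootPotential n t k - rootPotential n t (k - 1) +
    if k = t then 1 else 0) (fun t => by
      simp only [rootPotential_succ hn t, simpleRoot, Pi.add_apply, Pi.single_apply]
      push_cast
      simp only [sub_eq_iff_eq_add]
      ring) b a
  simp only [Pi.sub_apply]
  linarith

theorem lt_of_rootPotential_le (hn : 3 ≤ n) {a b : ℤ} (hab : (a : ZMod n) ≠ b)
    (h : ∀ i, rootPotential n a i ≤ rootPotential n b i) : a < b := by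
  by_contra hc
  have h1 : rootPotential n b - rootPotential n a = 0 :=
    funext fun i => sub_eq_zero.2 ((rootPotential_mono hn (not_lt.1 hc) i).antisymm (h i))
  have h2 := rootPotential_sub_pred hn a b a
  rw [h1, if_pos rfl, if_neg hab] at h2
  simp at h2

theorem IsRoot.rootAction {hn : 3 ≤ n} {v : RootLattice n} (h : IsRoot hn v) (w : W n) :
    IsRoot hn (rootAction hn w v) := by
  obtain ⟨u, i, rfl⟩ := h
  exact ⟨w * u, i, by rw [map_mul]; rfl⟩

/-- Induction on `b - a`: `s_{b-1}` carries the pair `(a, b - 1)` to `(a, b)`. If `a ≡ b - 1` that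
shorter pair gives no root, but then `s_a` moves both ends of `(a + 1, b - 1)` outwards. -/
theorem isRoot_sub (hn : 3 ≤ n) {a b : ℤ} (hab : a < b) (hne : (a : ZMod n) ≠ b) :
    IsRoot hn (rootPotential n b - rootPotential n a) := by
  induction hm : (b - a).toNat using Nat.strong_induction_on generalizing a b with
  | _ m ih =>
  subst hm
  by_cases h1 : b = a + 1
  · subst h1
    exact ⟨1, a, by rw [rootPotential_succ hn]; simp⟩
  by_cases h2 : (a : ZMod n) = ((b - 1 : ℤ) : ZMod n)
  · have hlt : a + 1 < b - 1 := by
      obtain ⟨k, hk⟩ := intCast_eq_iff.1 h2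
      have : 0 < k := by
        by_contra hk'
        have : k * n ≤ 0 := mul_nonpos_of_nonpos_of_nonneg (by omega) (by omega)
        omega
      have : (n : ℤ) ≤ k * n := le_mul_of_one_le_left (by omega) this
      omega
    have h3 := ih _ (by omega) hlt (by
      rw [← h2]; push_cast; simpa using (zmod_ne hn).1) rfl
    have h4 := h3.rootAction ((cs n).simple a)
    rw [rootAction_sub, toPerm_simple_succ, h2, toPerm_simple_self, sub_add_cancel] at h4
    exact h4
  · have h3 := ih _ (by omega) (by omega : a < b - 1) h2 rfl
    have h4 := h3.rootAction ((cs n).simple (b - 1 : ℤ))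
    rw [rootAction_sub, toPerm_simple_self, sub_add_cancel, toPerm_simple_of_ne hn h2 (by
      push_cast; rwa [sub_add_cancel])] at h4
    exact h4

theorem IsRoot.exists_eq_sub {hn : 3 ≤ n} {v : RootLattice n} (h : IsRoot hn v) :
    ∃ a b : ℤ, (a : ZMod n) ≠ b ∧ v = rootPotential n b - rootPotential n a := by
  obtain ⟨w, i, rfl⟩ := h
  obtain ⟨t, rfl⟩ := ZMod.intCast_surjective i
  refine ⟨toPerm hn w t, toPerm hn w (t + 1), ?_, ?_⟩
  · rw [Ne, intCast_apply_eq_iff (isAffinePerm_toPerm hn w).1]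
    push_cast
    simpa using (zmod_ne hn).1
  · rw [← rootAction_sub, rootPotential_succ hn, add_sub_cancel_left]

theorem isPositiveRoot_iff {hn : 3 ≤ n} {v : RootLattice n} :
    IsPositiveRoot hn v ↔ ∃ a b : ℤ, a < b ∧ (a : ZMod n) ≠ b ∧
      v = rootPotential n b - rootPotential n a := by
  constructor
  · rintro ⟨h, h0⟩
    obtain ⟨a, b, hab, rfl⟩ := h.exists_eq_sub
    exact ⟨a, b, lt_of_rootPotential_le hn hab fun i => sub_nonneg.1 (h0 i), hab, rfl⟩
  · rintro ⟨a, b, hab, hne, rfl⟩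
    exact ⟨isRoot_sub hn hab hne, fun i => sub_nonneg.2 (rootPotential_mono hn hab.le i)⟩

theorem isNegativeRoot_rootAction_iff (hn : 3 ≤ n) (w : W n) {a b : ℤ} (hab : a < b)
    (hne : (a : ZMod n) ≠ b) :
    IsNegativeRoot hn (rootAction hn w (rootPotential n b - rootPotential n a)) ↔
      toPerm hn w b < toPerm hn w a := by
  constructor
  · rintro ⟨-, h⟩
    rw [rootAction_sub] at h
    refine lt_of_rootPotential_le hn ?_ fun i => sub_nonpos.1 (h i)
    rw [Ne, intCast_apply_eq_iff (isAffinePerm_toPerm hn w).1]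
    exact hne.symm
  · intro h
    refine ⟨(isRoot_sub hn hab hne).rootAction w, fun i => ?_⟩
    rw [rootAction_sub]
    exact sub_nonpos.2 (rootPotential_mono hn h.le i)

/-! ### Composable inversions, and (iii) ⇔ (iv) -/

theorem not_is321Avoiding_of_intCast_eq (hn : 3 ≤ n) {w : W n} {a b c d : ℤ} (hab : a < b)
    (hcd : c < d) (hbc : (b : ZMod n) = c) (h1 : toPerm hn w b < toPerm hn w a)
    (h2 : toPerm hn w d < toPerm hn w c) : ¬ Is321Avoiding (toPerm hn w) := by
  obtain ⟨k, rfl⟩ := intCast_eq_iff.1 hbc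
  have e := toPerm_add_mul hn w (d - k * n) k
  rw [sub_add_cancel] at e
  rw [toPerm_add_mul] at h2
  exact not_not.2 ⟨a, b, d - k * n, hab, by linarith, h1, by linarith⟩

/-- If the sum of two roots is a root, then the roots are composable. -/
theorem intCast_eq_or_of_add (hn : 3 ≤ n) {a b c d e f : ℤ} (hab : (a : ZMod n) ≠ b)
    (hcd : (c : ZMod n) ≠ d)
    (h : rootPotential n b - rootPotential n a + (rootPotential n d - rootPotential n c) =
      rootPotential n f - rootPotential n e) : (b : ZMod n) = c ∨ (d : ZMod n) = a := by
  by_contra! hc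
  have key : ∀ k : ZMod n, ((if k = a then 1 else 0) - (if k = b then 1 else 0) : ℤ) +
      ((if k = c then 1 else 0) - (if k = d then 1 else 0)) =
      (if k = e then 1 else 0) - (if k = f then 1 else 0) := by
    intro k
    rw [← rootPotential_sub_pred hn, ← rootPotential_sub_pred hn, ← rootPotential_sub_pred hn,
      ← h, Pi.add_apply, Pi.add_apply]
    ring
  -- If neither pair composes, the left side is at least `1` at both `a` and `c`. Then `a` and `c`
  -- both equal `e` modulo `n`, so the left side is `2`, while the right side never exceeds `1`.
  have ka := key a
  have kc := key c
  rw [if_pos rfl, if_neg hab, if_neg hc.2.symm] at ka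
  rw [if_neg hc.1.symm, if_pos rfl, if_neg hcd] at kc
  grind

theorem is321Avoiding_iff_roots (hn : 3 ≤ n) (w : W n) :
    Is321Avoiding (toPerm hn w) ↔ ¬ ∃ α β : RootLattice n,
      IsPositiveRoot hn α ∧ IsPositiveRoot hn β ∧ IsPositiveRoot hn (α + β) ∧
      IsNegativeRoot hn (rootAction hn w α) ∧ IsNegativeRoot hn (rootAction hn w β) := by
  constructor
  · rintro h ⟨α, β, hα, hβ, hαβ, nα, nβ⟩
    obtain ⟨a, b, hab, hab', rfl⟩ := isPositiveRoot_iff.1 hα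
    obtain ⟨c, d, hcd, hcd', rfl⟩ := isPositiveRoot_iff.1 hβ
    obtain ⟨e, f, -, -, hef⟩ := isPositiveRoot_iff.1 hαβ
    rw [isNegativeRoot_rootAction_iff hn w hab hab'] at nα
    rw [isNegativeRoot_rootAction_iff hn w hcd hcd'] at nβ
    rcases intCast_eq_or_of_add hn hab' hcd' hef with h1 | h1
    · exact not_is321Avoiding_of_intCast_eq hn hab hcd h1 nα nβ h
    · exact not_is321Avoiding_of_intCast_eq hn hcd hab h1 nβ nα h
  · rintro h ⟨a, b, c, hab, hbc, h1, h2⟩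
    -- Incongruent endpoints are what make the three differences roots.
    have nab := intCast_ne_of_inversion hn hab h1
    have nbc := intCast_ne_of_inversion hn hbc h2
    have nac := intCast_ne_of_inversion hn (hab.trans hbc) (h2.trans h1)
    exact h ⟨rootPotential n b - rootPotential n a, rootPotential n c - rootPotential n b,
      isPositiveRoot_iff.2 ⟨a, b, hab, nab, rfl⟩, isPositiveRoot_iff.2 ⟨b, c, hbc, nbc, rfl⟩,
      isPositiveRoot_iff.2 ⟨a, c, hab.trans hbc, nac, by abel⟩,
      (isNegativeRoot_rootAction_iff hn w hab nab).2 h1,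
      (isNegativeRoot_rootAction_iff hn w hbc nbc).2 h2⟩

end AffineA

theorem theorem2p7 {n : ℕ} (hn : 3 ≤ n) :
    (Function.Injective (AffineA.toPerm hn) ∧
      Set.range (AffineA.toPerm hn) = {σ : Equiv.Perm ℤ | AffineA.IsAffinePerm n σ}) ∧
    ∀ w : AffineA.W n,
      List.TFAE
        [AffineA.IsFullyCommutative w,
         ∀ a b : ℤ, a < b → AffineA.toPerm hn w a > AffineA.toPerm hn w b →
           AffineA.toPerm hn w a > a ∧ AffineA.toPerm hn w b < b,
         AffineA.Is321Avoiding (AffineA.toPerm hn w),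
         ¬ ∃ α β : AffineA.RootLattice n,
           AffineA.IsPositiveRoot hn α ∧ AffineA.IsPositiveRoot hn β ∧
           AffineA.IsPositiveRoot hn (α + β) ∧
           AffineA.IsNegativeRoot hn (AffineA.rootAction hn w α) ∧
           AffineA.IsNegativeRoot hn (AffineA.rootAction hn w β)] := by
  refine ⟨⟨AffineA.toPerm_injective hn, AffineA.range_toPerm hn⟩, fun w => ?_⟩
  tfae_have 1 ↔ 3 := AffineA.isFullyCommutative_iff hn w
  tfae_have 3 ↔ 2 := AffineA.is321Avoiding_iff hn w
  tfae_have 3 ↔ 4 := AffineA.is321Avoiding_iff_roots hn w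
  tfae_finish
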